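/- Let $X_1,X_2,\dots$ be i.i.d. real random variables with mean $\mu>0$ and variance $\sigma^2>0$. Assume: 1. $\Lambda(a)=\log E e^{aX_1}<\infty$ for all $a\in\mathbb{R}$, $\Lambda$ is continuous, and $\sup_{a\in\mathbb{R}}\{-\Lambda(a)\}<\infty$; 2. there exist $\theta\in(0,1]$, $v>1$ and $b>0$ such that $E\exp(\theta|X_1|^v)\le e^b$. For $n\ge 1$ and $t\ge 0$ let $$\widetilde S_n(t)=\sum_{i=1}^{\lfloor nt\rfloor}X_i+(nt-\lfloor nt\rfloor)X_{\lfloor nt\rfloor+1},$$ and for $r\in(0,\mu)$ let $\tau_r^n=\inf\{t\ge 0:\widetilde S_n(t)\ge nr\}$ (with $\inf\emptyset=+\infty$) and $\tau_r=r/\mu$. Let $(a_n)_{n\ge1}$ be a positive sequence with $$\lim_{n\to\infty}\frac{a_n}{n}=\lim_{n\to\infty}\frac{\sqrt n}{a_n}=0.$$ Then, for every $r\in(0,\mu)$ and every $t>0$, $$\lim_{n\to\infty}\frac{n}{a_n^2}\log P\left(\frac{n}{a_n}(\tau_r^n-\tau_r)>t\right)=-\frac{\mu^3t^2}{2\sigma^2r}$$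 and $$\lim_{n\to\infty}\frac{n}{a_n^2}\log P\left(\frac{n}{a_n}(\tau_r^n-\tau_r)<-t\right)=-\frac{\mu^3t^2}{2\sigma^2r}.$$ -/

import Mathlib

open MeasureTheory ProbabilityTheory Filter Topology

noncomputable section

/-- The linearly interpolated trajectory of the partial sums at time `t ≥ 0`. The sequence is indexed
from `0`, so `X i` is the `(i + 1)`-st variable of the sequence. -/
def trajectory {Ω : Type*} (X : ℕ → Ω → ℝ) (n : ℕ) (t : ℝ) (ω : Ω) : ℝ :=
  ∑ i ∈ Finset.range ⌊(n : ℝ) * t⌋₊, X i ω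
    + ((n : ℝ) * t - (⌊(n : ℝ) * t⌋₊ : ℝ)) * X ⌊(n : ℝ) * t⌋₊ ω

/-- The hitting time of the level `n * r` by the `n`-th trajectory, `⊤` if it is never reached. -/
def hittingTime {Ω : Type*} (X : ℕ → Ω → ℝ) (n : ℕ) (r : ℝ) (ω : Ω) : EReal :=
  sInf ((fun t : ℝ => (t : EReal)) '' {t : ℝ | 0 ≤ t ∧ (n : ℝ) * r ≤ trajectory X n t ω})

/-- The logarithmic moment generating function `cgf Y P a = log E exp (a Y)` is finite everywhere,
continuous, and bounded below. -/
def LogMomentCondition {Ω : Type*} [MeasurableSpace Ω] (Y : Ω → ℝ) (P : Measure Ω) : Prop :=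
  (∀ a : ℝ, Integrable (fun ω => Real.exp (a * Y ω)) P) ∧
    Continuous (fun a : ℝ => cgf Y P a) ∧
    BddAbove (Set.range fun a : ℝ => -cgf Y P a)

/-- For some `θ ∈ (0, 1]`, `v > 1` and `b > 0`, `E exp (θ |Y| ^ v) ≤ exp b`. -/
def SuperExponentialCondition {Ω : Type*} [MeasurableSpace Ω] (Y : Ω → ℝ) (P : Measure Ω) : Prop :=
  ∃ θ v b : ℝ, 0 < θ ∧ θ ≤ 1 ∧ 1 < v ∧ 0 < b ∧
    Integrable (fun ω => Real.exp (θ * |Y ω| ^ v)) P ∧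
    ∫ ω, Real.exp (θ * |Y ω| ^ v) ∂P ≤ Real.exp b

end

/-! Put `T = n r / μ + t a_n`. The event that the level `n r` is hit after time `T / n` is almost
the event that the partial sum of about `T` variables is below `n r`, i.e. that the sum centred by
`μ T` is below `-μ t a_n`. Since the cumulant generating function is quadratic near `0` and `a_n / n
→ 0`, the centred sum over `a_n` has Gaussian scaled cumulants of variance `σ² r / μ` at speed `a_n²
/ n` (`hasGaussianScaledCgf_sum`). The Gaussian rate `(μ t)² / (2 σ² r / μ)` is the claimed one, and
`-t` is symmetric.

Partial sums are not monotone, so each comparison is exact in one direction only. In the other it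
fails only if the walk ends at least `ε a_n` below an earlier value. The drift is positive, so this
costs `exp (-c a_n)` up to a polynomial factor, negligible at speed `a_n² / n`
(`eventually_measure_increment_le`). `tendsto_log_measure_of_sandwich` combines the two estimates.
-/

/-! ### Tail bounds from Gaussian scaled cumulants. -/

section GaussianTails

variable {Ω : Type*} [MeasurableSpace Ω] {P : Measure Ω} [IsProbabilityMeasure P]

/-- The scaled cumulant generating functions of `Z n` at speed `s n` converge to that of a centred
Gaussian variable of variance `κ`. -/
structure HasGaussianScaledCgf (P : Measure Ω) (Z : ℕ → Ω → ℝ) (s : ℕ → ℝ) (κ : ℝ) : Prop where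
  measurable : ∀ n, Measurable (Z n)
  integrable : ∀ n θ, Integrable (fun ω => Real.exp (θ * Z n ω)) P
  tendsto : ∀ θ : ℝ, Tendsto (fun n => cgf (Z n) P (θ * s n) / s n) atTop (𝓝 (κ * θ ^ 2 / 2))

variable {Z : ℕ → Ω → ℝ} {s : ℕ → ℝ} {κ : ℝ}

theorem HasGaussianScaledCgf.eventually_mgf_le (h : HasGaussianScaledCgf P Z s κ)
    (hs : Tendsto s atTop atTop) {θ c : ℝ} (hc : κ * θ ^ 2 / 2 < c) :
    ∀ᶠ n in atTop, mgf (Z n) P (θ * s n) ≤ Real.exp (c * s n) := by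
  filter_upwards [(h.tendsto θ).eventually_lt_const hc, hs.eventually_gt_atTop 0] with n hn hpos
  rw [← exp_cgf (h.integrable n _), Real.exp_le_exp]
  exact ((div_lt_iff₀ hpos).1 hn).le

theorem HasGaussianScaledCgf.eventually_le_mgf (h : HasGaussianScaledCgf P Z s κ)
    (hs : Tendsto s atTop atTop) {θ c : ℝ} (hc : c < κ * θ ^ 2 / 2) :
    ∀ᶠ n in atTop, Real.exp (c * s n) ≤ mgf (Z n) P (θ * s n) := by
  filter_upwards [(h.tendsto θ).eventually_const_lt hc, hs.eventually_gt_atTop 0] with n hn hpos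
  rw [← exp_cgf (h.integrable n _), Real.exp_le_exp]
  exact ((lt_div_iff₀ hpos).1 hn).le

/-- Chernoff upper bound on the tails. -/
theorem HasGaussianScaledCgf.eventually_measure_ge_le (h : HasGaussianScaledCgf P Z s κ)
    (hs : Tendsto s atTop atTop) (hκ : 0 < κ) {x I : ℝ} (hx : 0 ≤ x) (hI : I < x ^ 2 / (2 * κ)) :
    ∀ᶠ n in atTop, P.real {ω | x ≤ Z n ω} ≤ Real.exp (-I * s n) := by
  -- The optimal Chernoff parameter is `x / κ`, the maximiser of `θ x - κ θ² / 2`.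
  have hc : κ * (x / κ) ^ 2 / 2 < x ^ 2 / κ - I := by
    have : κ * (x / κ) ^ 2 / 2 = x ^ 2 / κ - x ^ 2 / (2 * κ) := by field_simp; ring
    linarith
  filter_upwards [h.eventually_mgf_le hs hc, hs.eventually_gt_atTop 0] with n hn hpos
  refine (measure_ge_le_exp_mul_mgf (t := x / κ * s n) x (by positivity) (h.integrable n _)).trans ?_
  refine (mul_le_mul_of_nonneg_left hn (Real.exp_pos _).le).trans ?_
  rw [← Real.exp_add, Real.exp_le_exp]
  apply le_of_eq
  ring

/-- The exponential of a variable is dominated by its value on a window and by two exponentials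
that charge the complement of the window. -/
theorem exp_mul_le_window (lam h y δ s z : ℝ) (hl : 0 ≤ lam) (hh : 0 ≤ h) (hs : 0 ≤ s) :
    Real.exp (lam * s * z) ≤ Real.exp (lam * s * (y + δ)) * Set.indicator (Set.Ioi (y - δ)) 1 z
      + Real.exp (-(h * s * (y + δ))) * Real.exp ((lam + h) * s * z)
      + Real.exp (h * s * (y - δ)) * Real.exp ((lam - h) * s * z) := by
  rw [← Real.exp_add, ← Real.exp_add]
  have p1 := Real.exp_pos (-(h * s * (y + δ)) + (lam + h) * s * z)
  have p2 := Real.exp_pos (h * s * (y - δ) + (lam - h) * s * z)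
  rcases le_or_gt z (y - δ) with hz | hz
  · have : Real.exp (lam * s * z) ≤ Real.exp (h * s * (y - δ) + (lam - h) * s * z) := by
      rw [Real.exp_le_exp]
      have := mul_le_mul_of_nonneg_left hz (mul_nonneg hh hs)
      linarith
    rw [Set.indicator_of_notMem (by simpa using hz)]
    linarith
  · rw [Set.indicator_of_mem (by simpa using hz), Pi.one_apply, mul_one]
    rcases le_or_gt z (y + δ) with hz' | hz'
    · have : Real.exp (lam * s * z) ≤ Real.exp (lam * s * (y + δ)) := by
        rw [Real.exp_le_exp]
        exact mul_le_mul_of_nonneg_left hz' (mul_nonneg hl hs)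
      linarith
    · have : Real.exp (lam * s * z) ≤ Real.exp (-(h * s * (y + δ)) + (lam + h) * s * z) := by
        rw [Real.exp_le_exp]
        have := mul_le_mul_of_nonneg_left hz'.le (mul_nonneg hh hs)
        linarith
      have := Real.exp_pos (lam * s * (y + δ))
      linarith

/-- This replaces the change of measure in the usual lower bound: if `lam` is the tilt centred at
`y`, shifting the tilt by `±h` shows that the last two terms are negligible, so the window must
carry the moment generating function. -/
theorem mgf_le_window {Y : Ω → ℝ} (hY : Measurable Y)
    (hint : ∀ θ, Integrable (fun ω => Real.exp (θ * Y ω)) P)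
    (lam h y δ s : ℝ) (hl : 0 ≤ lam) (hh : 0 ≤ h) (hs : 0 ≤ s) :
    mgf Y P (lam * s) ≤ Real.exp (lam * s * (y + δ)) * P.real {ω | y - δ < Y ω}
      + Real.exp (-(h * s * (y + δ))) * mgf Y P ((lam + h) * s)
      + Real.exp (h * s * (y - δ)) * mgf Y P ((lam - h) * s) := by
  have hm : MeasurableSet {ω | y - δ < Y ω} := measurableSet_lt measurable_const hY
  have hind : ∀ ω, Set.indicator (Set.Ioi (y - δ)) (1 : ℝ → ℝ) (Y ω)
      = Set.indicator {ω | y - δ < Y ω} (1 : Ω → ℝ) ω := fun ω => by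
    simp [Set.indicator_apply]
  have i1 : Integrable (Set.indicator {ω | y - δ < Y ω} (1 : Ω → ℝ)) P :=
    (integrable_const (1 : ℝ)).indicator hm
  have j1 := i1.const_mul (Real.exp (lam * s * (y + δ)))
  have j2 := (hint ((lam + h) * s)).const_mul (Real.exp (-(h * s * (y + δ))))
  have j3 := (hint ((lam - h) * s)).const_mul (Real.exp (h * s * (y - δ)))
  have hsum := integral_add (j1.add j2) j3
  have hsum' := integral_add j1 j2
  simp only [Pi.add_apply] at hsum
  rw [← integral_indicator_one hm, mgf, mgf, mgf, ← integral_const_mul, ← integral_const_mul,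
    ← integral_const_mul, ← hsum', ← hsum]
  refine integral_mono (hint _) ((j1.add j2).add j3) fun ω => ?_
  have := exp_mul_le_window lam h y δ s (Y ω) hl hh hs
  rwa [hind] at this

/-- Lower bound on the tails. -/
theorem HasGaussianScaledCgf.eventually_le_measure_gt (h : HasGaussianScaledCgf P Z s κ)
    (hs : Tendsto s atTop atTop) (hκ : 0 < κ) {x I : ℝ} (hx : 0 ≤ x) (hI : x ^ 2 / (2 * κ) < I) :
    ∀ᶠ n in atTop, Real.exp (-I * s n) ≤ P.real {ω | x < Z n ω} := by
  -- The quantity bounded by `I` is the total cost at `y = x + δ`: `y (y + δ) / κ` from the window,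
  -- minus `y² / (2κ)` from the tilt, plus the slack `2e` with `e = δ² / (8κ)`.
  obtain ⟨δ, hδ, hδI⟩ : ∃ δ > 0,
      ((x + δ) ^ 2 / 2 + (x + δ) * δ + δ ^ 2 / 4) / κ < I := by
    have hcont : Tendsto (fun δ : ℝ => ((x + δ) ^ 2 / 2 + (x + δ) * δ + δ ^ 2 / 4) / κ) (𝓝[>] 0)
        (𝓝 (((x + 0) ^ 2 / 2 + (x + 0) * 0 + 0 ^ 2 / 4) / κ)) :=
      (Continuous.tendsto (by fun_prop) 0).mono_left nhdsWithin_le_nhds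
    have hlt : ((x + 0) ^ 2 / 2 + (x + 0) * 0 + 0 ^ 2 / 4) / κ < I := by
      convert hI using 1
      field_simp
      ring
    obtain ⟨δ, h1, h2⟩ := ((hcont.eventually_lt_const hlt).and self_mem_nhdsWithin).exists
    exact ⟨δ, h2, h1⟩
  set y := x + δ with hy
  -- Shifting the tilt by `δ / κ` gains `δ² / (2κ) = 4e` in the exponent; the approximation errors
  -- use `2e`, and the remaining `2e` makes each side term at most a quarter of `A`.
  set e := δ ^ 2 / (8 * κ) with he
  have hepos : 0 < e := by positivity
  have c1 : κ * (y / κ) ^ 2 / 2 - e < κ * (y / κ) ^ 2 / 2 := by linarith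
  have c2 : κ * (y / κ + δ / κ) ^ 2 / 2 < κ * (y / κ + δ / κ) ^ 2 / 2 + e := by linarith
  have c3 : κ * (y / κ - δ / κ) ^ 2 / 2 < κ * (y / κ - δ / κ) ^ 2 / 2 + e := by linarith
  filter_upwards [h.eventually_le_mgf hs c1, h.eventually_mgf_le hs c2, h.eventually_mgf_le hs c3,
    hs.eventually_ge_atTop 0,
    (hs.const_mul_atTop hepos).eventually_ge_atTop (Real.log 4)] with n h1 h2 h3 hpos h4
  have hy0 : 0 ≤ y := by positivity
  have key := mgf_le_window (h.measurable n) (h.integrable n) (y / κ) (δ / κ) y δ (s n)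
    (by positivity) (by positivity) hpos
  have hyx : y - δ = x := by simp [hy]
  rw [hyx] at key
  set A := Real.exp ((κ * (y / κ) ^ 2 / 2 - e) * s n) with hA
  have hsmall : Real.exp (-(e * s n)) ≤ 1 / 4 := by
    rw [Real.exp_neg, one_div]
    exact inv_anti₀ (by norm_num) ((Real.log_le_iff_le_exp (by norm_num)).1 h4)
  have hexp2 : Real.exp (-(2 * (e * s n))) ≤ 1 / 4 :=
    (Real.exp_le_exp.2 (by have := mul_nonneg hepos.le hpos; linarith)).trans hsmall
  have t2 : Real.exp (-(δ / κ * s n * (y + δ))) * mgf (Z n) P ((y / κ + δ / κ) * s n)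
      ≤ A * (1 / 4) := by
    refine (mul_le_mul_of_nonneg_left h2 (Real.exp_pos _).le).trans ?_
    refine le_trans (le_of_eq ?_) (mul_le_mul_of_nonneg_left hexp2 (Real.exp_pos _).le)
    rw [hA, ← Real.exp_add, ← Real.exp_add, he]
    congr 1
    field_simp
    ring
  have t3 : Real.exp (δ / κ * s n * x) * mgf (Z n) P ((y / κ - δ / κ) * s n)
      ≤ A * (1 / 4) := by
    refine (mul_le_mul_of_nonneg_left h3 (Real.exp_pos _).le).trans ?_
    refine le_trans (le_of_eq ?_) (mul_le_mul_of_nonneg_left hexp2 (Real.exp_pos _).le)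
    rw [hA, ← Real.exp_add, ← Real.exp_add, he, ← hyx]
    congr 1
    field_simp
    ring
  have t1 : A * (1 / 2) ≤ Real.exp (y / κ * s n * (y + δ)) * P.real {ω | x < Z n ω} := by
    linarith
  have t0 : Real.exp (y / κ * s n * (y + δ)) * Real.exp (-I * s n) ≤ A * (1 / 2) := by
    refine le_trans ?_ (mul_le_mul_of_nonneg_left (hsmall.trans (by norm_num)) (Real.exp_pos _).le)
    rw [hA, ← Real.exp_add, ← Real.exp_add, Real.exp_le_exp]
    have e1 : (κ * (y / κ) ^ 2 / 2 - e) * s n + -(e * s n) - y / κ * s n * (y + δ)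
        = -((y ^ 2 / 2 + y * δ + δ ^ 2 / 4) / κ) * s n := by
      rw [he]
      field_simp
      ring
    have := mul_le_mul_of_nonneg_right hδI.le hpos
    linarith
  exact le_of_mul_le_mul_left (t0.trans t1) (Real.exp_pos _)

end GaussianTails

/-! ### From exponential bounds to logarithmic limits. -/

/-- A logarithmic limit from exponential bounds at speed `s n`. -/
theorem tendsto_inv_mul_ennreal_log {p : ℕ → ENNReal} {s : ℕ → ℝ} {J : ℝ}
    (hs : Tendsto s atTop atTop)
    (hlow : ∀ I, J < I → ∀ᶠ n in atTop, Real.exp (-I * s n) ≤ (p n).toReal)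
    (hup : ∀ I, I < J → ∀ᶠ n in atTop, (p n).toReal ≤ Real.exp (-I * s n)) :
    Tendsto (fun n => (((s n)⁻¹ : ℝ) : EReal) * ENNReal.log (p n)) atTop
      (𝓝 ((-J : ℝ) : EReal)) := by
  have hlog : ∀ᶠ n in atTop, (((s n)⁻¹ * Real.log (p n).toReal : ℝ) : EReal)
      = (((s n)⁻¹ : ℝ) : EReal) * ENNReal.log (p n) := by
    filter_upwards [hlow (J + 1) (by linarith)] with n hn
    rw [ENNReal.log_pos_real' (lt_of_lt_of_le (Real.exp_pos _) hn), EReal.coe_mul]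
  refine Tendsto.congr' hlog ((continuous_coe_real_ereal.tendsto _).comp ?_)
  refine tendsto_order.2 ⟨fun c hc => ?_, fun c hc => ?_⟩
  · obtain ⟨d, hcd, hdJ⟩ := exists_between hc
    filter_upwards [hlow (-d) (by linarith), hs.eventually_gt_atTop 0] with n hn hpos
    have := Real.log_le_log (Real.exp_pos _) hn
    rw [Real.log_exp, neg_neg] at this
    rw [inv_mul_eq_div]
    exact hcd.trans_le ((le_div_iff₀ hpos).2 this)
  · obtain ⟨d, hdJ, hcd⟩ := exists_between hc
    filter_upwards [hup (-d) (by linarith), hlow (J + 1) (by linarith),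
      hs.eventually_gt_atTop 0] with n hn hn' hpos
    have := Real.log_le_log (lt_of_lt_of_le (Real.exp_pos _) hn') hn
    rw [Real.log_exp, neg_neg] at this
    rw [inv_mul_eq_div]
    exact ((div_le_iff₀ hpos).2 this).trans_lt hcd

section Sandwich

variable {Ω : Type*} [MeasurableSpace Ω] {P : Measure Ω} [IsProbabilityMeasure P]

/-- Moderate deviations of events that are tail events of asymptotically Gaussian variables up to
small shifts and up to superexponentially small errors. -/
theorem tendsto_log_measure_of_sandwich {Z Z' : ℕ → Ω → ℝ} {s : ℕ → ℝ} {κ x : ℝ}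
    (hZ : HasGaussianScaledCgf P Z s κ) (hZ' : HasGaussianScaledCgf P Z' s κ)
    (hs : Tendsto s atTop atTop) (hκ : 0 < κ) (hx : 0 < x) (A : ℕ → Set Ω) (D : ℝ → ℕ → Set Ω)
    (hD : ∀ ε, 0 < ε → ∀ K : ℝ, ∀ᶠ n in atTop, P.real (D ε n) ≤ Real.exp (-K * s n))
    (hupper : ∀ ε, 0 < ε → ∀ᶠ n in atTop, A n ⊆ {ω | x - ε ≤ Z n ω} ∪ D ε n)
    (hlower : ∀ ε, 0 < ε → ∀ᶠ n in atTop, {ω | x + ε < Z' n ω} ⊆ A n ∪ D ε n) :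
    Tendsto (fun n => (((s n)⁻¹ : ℝ) : EReal) * ENNReal.log (P (A n))) atTop
      (𝓝 ((-(x ^ 2 / (2 * κ)) : ℝ) : EReal)) := by
  refine tendsto_inv_mul_ennreal_log hs (fun I hI => ?_)
    (fun I hI => ?_)
  · obtain ⟨I', hI', hII'⟩ := exists_between hI
    obtain ⟨ε, hε, hεI⟩ : ∃ ε > 0, (x + ε) ^ 2 / (2 * κ) < I' := by
      have hcont : Tendsto (fun ε : ℝ => (x + ε) ^ 2 / (2 * κ)) (𝓝[>] 0)
          (𝓝 ((x + 0) ^ 2 / (2 * κ))) :=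
        (Continuous.tendsto (by fun_prop) 0).mono_left nhdsWithin_le_nhds
      obtain ⟨ε, h1, h2⟩ :=
        ((hcont.eventually_lt_const (by simpa using hI')).and self_mem_nhdsWithin).exists
      exact ⟨ε, h2, h1⟩
    -- The gap between the two rates absorbs a factor `2` once `s n` is large, which pays for the
    -- exceptional set.
    have hgap : 0 < I - I' := by linarith
    filter_upwards [hlower ε hε, hD ε hε I,
      hZ'.eventually_le_measure_gt hs hκ (by positivity) hεI,
      (hs.const_mul_atTop hgap).eventually_ge_atTop (Real.log 2)] with n h1 h2 h3 h4
    have h5 : P.real {ω | x + ε < Z' n ω} ≤ P.real (A n) + P.real (D ε n) :=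
      (measureReal_mono h1).trans (measureReal_union_le _ _)
    have h6 : 2 * Real.exp (-I * s n) ≤ Real.exp (-I' * s n) := by
      have : Real.exp (-I' * s n) = Real.exp ((I - I') * s n) * Real.exp (-I * s n) := by
        rw [← Real.exp_add]; congr 1; ring
      rw [this]
      exact mul_le_mul_of_nonneg_right ((Real.log_le_iff_le_exp (by norm_num)).1 h4)
        (Real.exp_pos _).le
    change _ ≤ P.real (A n)
    linarith
  · obtain ⟨I', hII', hI'⟩ := exists_between hI
    obtain ⟨ε, ⟨hε, hεx⟩, hεI⟩ : ∃ ε, (0 < ε ∧ ε < x) ∧ I' < (x - ε) ^ 2 / (2 * κ) := by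
      have hcont : Tendsto (fun ε : ℝ => (x - ε) ^ 2 / (2 * κ)) (𝓝[>] 0)
          (𝓝 ((x - 0) ^ 2 / (2 * κ))) :=
        (Continuous.tendsto (by fun_prop) 0).mono_left nhdsWithin_le_nhds
      obtain ⟨ε, h1, h2⟩ :=
        ((hcont.eventually_const_lt (by simpa using hI')).and (Ioo_mem_nhdsGT hx)).exists
      exact ⟨ε, h2, h1⟩
    have hgap : 0 < I' - I := by linarith
    filter_upwards [hupper ε hε, hD ε hε I',
      hZ.eventually_measure_ge_le hs hκ (by linarith) hεI,
      (hs.const_mul_atTop hgap).eventually_ge_atTop (Real.log 2)] with n h1 h2 h3 h4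
    have h5 : P.real (A n) ≤ P.real {ω | x - ε ≤ Z n ω} + P.real (D ε n) :=
      (measureReal_mono h1).trans (measureReal_union_le _ _)
    have h6 : 2 * Real.exp (-I' * s n) ≤ Real.exp (-I * s n) := by
      have : Real.exp (-I * s n) = Real.exp ((I' - I) * s n) * Real.exp (-I' * s n) := by
        rw [← Real.exp_add]; congr 1; ring
      rw [this]
      exact mul_le_mul_of_nonneg_right ((Real.log_le_iff_le_exp (by norm_num)).1 h4)
        (Real.exp_pos _).le
    change P.real (A n) ≤ _
    linarith

end Sandwich

/-! ### Cumulants and increments of the random walk. -/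

section PartialSums

variable {Ω : Type*} [MeasurableSpace Ω] {P : Measure Ω} [IsProbabilityMeasure P]

/-- Second order expansion of the cumulant generating function at `0`. -/
theorem exists_cgf_eq_quadratic {Y : Ω → ℝ} (hY : Measurable Y)
    (hint : ∀ θ, Integrable (fun ω => Real.exp (θ * Y ω)) P) :
    ∃ ρ : ℝ → ℝ, Tendsto ρ (𝓝 0) (𝓝 0) ∧
      ∀ h, cgf Y P h = (∫ ω, Y ω ∂P) * h + (variance Y P / 2 + ρ h) * h ^ 2 := by
  have hset : integrableExpSet Y P = Set.univ := Set.eq_univ_of_forall hint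
  have hmem : ∀ v, v ∈ interior (integrableExpSet Y P) := by simp [hset]
  have hsmooth : ContDiff ℝ 2 (cgf Y P) := by
    have := analyticOnNhd_cgf (X := Y) (μ := P)
    rw [hset, interior_univ] at this
    exact this.contDiff
  have hd1 : deriv (cgf Y P) 0 = ∫ ω, Y ω ∂P := by
    simp [deriv_cgf_zero (hmem 0)]
  have hd2 : iteratedDeriv 2 (cgf Y P) 0 = variance Y P := by
    rw [iteratedDeriv_two_cgf_eq_integral (hmem 0), hd1, variance_eq_integral hY.aemeasurable]
    simp
  have htaylor : ∀ h, taylorWithinEval (cgf Y P) 2 Set.univ 0 h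
      = (∫ ω, Y ω ∂P) * h + variance Y P / 2 * h ^ 2 := fun h => by
    rw [taylorWithinEval_succ, taylorWithinEval_succ, taylor_within_zero_eval,
      iteratedDerivWithin_univ, iteratedDerivWithin_univ, zero_add, iteratedDeriv_one, hd1]
    norm_num
    rw [hd2]
    ring
  refine ⟨fun h => (cgf Y P h - taylorWithinEval (cgf Y P) 2 Set.univ 0 h) / h ^ 2, ?_,
    fun h => ?_⟩
  · simpa using Real.taylor_tendsto convex_univ (Set.mem_univ (0 : ℝ)) (n := 2)
      hsmooth.contDiffOn
  · rcases eq_or_ne h 0 with rfl | hh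
    · simp
    · simp only [htaylor]
      field_simp
      ring

variable {X : ℕ → Ω → ℝ}

/-- An arbitrary index set serves both the initial segments and the blocks `Finset.Ico k (N n)`. -/
theorem cgf_sum_of_identDistrib (hX : ∀ i, Measurable (X i)) (hindep : iIndepFun X P)
    (hident : ∀ i, IdentDistrib (X i) (X 0) P P)
    (hint : ∀ θ, Integrable (fun ω => Real.exp (θ * X 0 ω)) P) (I : Finset ℕ) (θ : ℝ) :
    Integrable (fun ω => Real.exp (θ * ∑ i ∈ I, X i ω)) P ∧
      cgf (fun ω => ∑ i ∈ I, X i ω) P θ = I.card * cgf (X 0) P θ := by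
  have hi : ∀ i ∈ I, Integrable (fun ω => Real.exp (θ * X i ω)) P := fun i _ =>
    ((hident i).comp (measurable_const_mul θ).exp).integrable_iff.2 (hint θ)
  have hfun : (fun ω => ∑ i ∈ I, X i ω) = ∑ i ∈ I, X i := by
    ext ω
    simp
  constructor
  · simpa using hindep.integrable_exp_mul_sum hX hi
  · rw [hfun, hindep.cgf_sum hX hi, Finset.sum_congr rfl fun i _ =>
      show cgf (X i) P θ = cgf (X 0) P θ by
        rw [cgf, cgf, mgf_congr_identDistrib (hident i)]]
    simp

/-- Moderate deviation asymptotics of the cumulant generating functions of partial sums. -/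
theorem hasGaussianScaledCgf_sum (hX : ∀ i, Measurable (X i)) (hindep : iIndepFun X P)
    (hident : ∀ i, IdentDistrib (X i) (X 0) P P)
    (hint : ∀ θ, Integrable (fun ω => Real.exp (θ * X 0 ω)) P) {μ v c C e : ℝ}
    (hmean : ∫ ω, X 0 ω ∂P = μ) (hvar : variance (X 0) P = v) (he : e ^ 2 = 1)
    {a : ℕ → ℝ} (ha : ∀ n : ℕ, 1 ≤ n → 0 < a n)
    (ha_upper : Tendsto (fun n : ℕ => a n / (n : ℝ)) atTop (𝓝 0))
    (ha_top : Tendsto a atTop atTop)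
    {N : ℕ → ℕ} {T : ℕ → ℝ} (hNT : ∀ᶠ n in atTop, |(N n : ℝ) - T n| ≤ C)
    (hT : Tendsto (fun n => T n / (n : ℝ)) atTop (𝓝 c)) :
    HasGaussianScaledCgf P (fun n ω => e * (∑ i ∈ Finset.range (N n), X i ω - μ * T n) / a n)
      (fun n => a n ^ 2 / n) (v * c) := by
  have hsums := cgf_sum_of_identDistrib hX hindep hident hint
  have hexp : ∀ n θ ω, Real.exp (θ * (e * (∑ i ∈ Finset.range (N n), X i ω - μ * T n) / a n))
      = Real.exp (-(θ * e * μ * T n / a n))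
        * Real.exp (θ * e / a n * ∑ i ∈ Finset.range (N n), X i ω) := fun n θ ω => by
    rw [← Real.exp_add]
    congr 1
    ring
  have hcgf : ∀ n θ, cgf (fun ω => e * (∑ i ∈ Finset.range (N n), X i ω - μ * T n) / a n) P θ
      = N n * cgf (X 0) P (θ * e / a n) - θ * e * μ * T n / a n := fun n θ => by
    have h2 := (hsums (Finset.range (N n)) (θ * e / a n)).2
    rw [Finset.card_range] at h2
    rw [← h2, cgf, mgf]
    simp_rw [hexp]
    rw [integral_const_mul, Real.log_mul (Real.exp_pos _).ne', Real.log_exp, cgf, mgf]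
    · ring
    · exact (mgf_pos (hsums (Finset.range (N n)) (θ * e / a n)).1).ne'
  refine ⟨fun n => by fun_prop, fun n θ => ?_, fun θ => ?_⟩
  · simp_rw [hexp]
    exact (hsums _ _).1.const_mul _
  obtain ⟨ρ, hρ, hΛ⟩ := exists_cgf_eq_quadratic (hX 0) hint
  rw [hmean, hvar] at hΛ
  have hNn : Tendsto (fun n => ((N n : ℝ) - T n) / n) atTop (𝓝 0) := by
    refine squeeze_zero_norm' ?_ (tendsto_const_div_atTop_nhds_zero_nat C)
    filter_upwards [hNT] with n hn
    rw [norm_div, Real.norm_eq_abs, Real.norm_natCast]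
    gcongr
  have hNa : Tendsto (fun n => ((N n : ℝ) - T n) / a n) atTop (𝓝 0) := by
    refine squeeze_zero_norm' ?_ (ha_top.const_div_atTop C)
    filter_upwards [hNT, ha_top.eventually_gt_atTop 0] with n hn hpos
    rw [norm_div, Real.norm_eq_abs, Real.norm_of_nonneg hpos.le]
    gcongr
  have harg : Tendsto (fun n : ℕ => ρ (θ * e * (a n / n))) atTop (𝓝 0) := by
    refine hρ.comp ?_
    simpa using ha_upper.const_mul (θ * e)
  -- After division by the speed, the linear terms cancel up to `θ e μ (N - T) / a_n`, which
  -- vanishes since `N - T` is bounded; the quadratic term leaves `(N / n) (v / 2 + ρ) θ²`.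
  have hlim := (hNa.const_mul (θ * e * μ)).add
    (((hNn.add hT).mul ((harg.const_add (v / 2)))).mul_const (θ ^ 2))
  have heq : θ * e * μ * 0 + (0 + c) * (v / 2 + 0) * θ ^ 2 = v * c * θ ^ 2 / 2 := by ring
  rw [heq] at hlim
  refine hlim.congr' ?_
  filter_upwards [eventually_ge_atTop 1] with n hn
  have hapos := (ha n hn).ne'
  have hnpos : (n : ℝ) ≠ 0 := by positivity
  have harg_eq : θ * (a n ^ 2 / n) * e / a n = θ * e * (a n / n) := by field_simp
  rw [hcgf, harg_eq, hΛ]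
  have hsq : (θ * e * (a n / n)) ^ 2 = θ ^ 2 * (a n / n) ^ 2 := by
    rw [mul_pow, mul_pow, he, mul_one]
  rw [hsq]
  field_simp
  ring

/-- Negative increments of order `a n` of a random walk with positive drift are superexponentially
unlikely at speed `a n ^ 2 / n`. -/
theorem eventually_measure_increment_le (hX : ∀ i, Measurable (X i)) (hindep : iIndepFun X P)
    (hident : ∀ i, IdentDistrib (X i) (X 0) P P)
    (hint : ∀ θ, Integrable (fun ω => Real.exp (θ * X 0 ω)) P)
    (hmean : 0 < ∫ ω, X 0 ω ∂P) {a : ℕ → ℝ}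
    (ha_upper : Tendsto (fun n : ℕ => a n / (n : ℝ)) atTop (𝓝 0))
    (ha_top : Tendsto a atTop atTop)
    (ha_sqrt : ∀ᶠ n : ℕ in atTop, (n : ℝ) ≤ a n ^ 2)
    {N : ℕ → ℕ} {C : ℝ} (hN : ∀ᶠ n in atTop, (N n : ℝ) + 1 ≤ C * n)
    {ε : ℝ} (hε : 0 < ε) (K : ℝ) :
    ∀ᶠ n in atTop, P.real {ω | ∃ k ≤ N n,
      ∑ i ∈ Finset.range (N n), X i ω ≤ ∑ i ∈ Finset.range k, X i ω - ε * a n}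
        ≤ Real.exp (-K * (a n ^ 2 / n)) := by
  -- The function `θ ↦ Λ(-θ)` vanishes at `0` with slope minus the mean, so it is negative just to
  -- the right. Such a `θ` bounds every block uniformly in its length.
  obtain ⟨θ, hθ, hΛθ⟩ : ∃ θ > 0, cgf (X 0) P (-θ) ≤ 0 := by
    obtain ⟨ρ, hρ, hΛ⟩ := exists_cgf_eq_quadratic (hX 0) hint
    have hneg : Tendsto (fun θ : ℝ => -θ) (𝓝 0) (𝓝 0) := by
      simpa using (continuous_neg (G := ℝ)).tendsto 0
    have hlim : Tendsto (fun θ => -(∫ ω, X 0 ω ∂P) + (variance (X 0) P / 2 + ρ (-θ)) * θ)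
        (𝓝[>] 0) (𝓝 (-(∫ ω, X 0 ω ∂P) + (variance (X 0) P / 2 + 0) * 0)) :=
      ((((hρ.comp hneg).const_add _).mul tendsto_id).const_add _).mono_left nhdsWithin_le_nhds
    obtain ⟨θ, h1, h2⟩ := ((hlim.eventually_lt_const (u := 0) (by simpa using hmean)).and
      self_mem_nhdsWithin).exists
    refine ⟨θ, h2, ?_⟩
    rw [hΛ]
    have := mul_nonpos_of_nonneg_of_nonpos (le_of_lt h2) h1.le
    linarith
  have hsums := cgf_sum_of_identDistrib hX hindep hident hint
  have hone : ∀ n k, k ≤ N n → P.real {ω | ∑ i ∈ Finset.range (N n), X i ω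
      ≤ ∑ i ∈ Finset.range k, X i ω - ε * a n} ≤ Real.exp (-(θ * ε * a n)) := fun n k hk => by
    obtain ⟨h1, h2⟩ := hsums (Finset.Ico k (N n)) (-θ)
    have hset : {ω | ∑ i ∈ Finset.range (N n), X i ω ≤ ∑ i ∈ Finset.range k, X i ω - ε * a n}
        = {ω | ∑ i ∈ Finset.Ico k (N n), X i ω ≤ -(ε * a n)} := by
      ext ω
      simp only [Set.mem_ofPred_eq, Finset.sum_Ico_eq_sub _ hk]
      constructor <;> intro h <;> linarith
    rw [hset]
    refine (measure_le_le_exp_cgf _ (by linarith) h1).trans ?_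
    rw [h2, Real.exp_le_exp]
    have := mul_nonpos_of_nonneg_of_nonpos (Nat.cast_nonneg (α := ℝ) (Finset.Ico k (N n)).card) hΛθ
    linarith
  have hunion : ∀ n, P.real {ω | ∃ k ≤ N n,
      ∑ i ∈ Finset.range (N n), X i ω ≤ ∑ i ∈ Finset.range k, X i ω - ε * a n}
        ≤ (N n + 1) * Real.exp (-(θ * ε * a n)) := fun n => by
    have hset : {ω | ∃ k ≤ N n, ∑ i ∈ Finset.range (N n), X i ω
        ≤ ∑ i ∈ Finset.range k, X i ω - ε * a n}
        = ⋃ k ∈ Finset.range (N n + 1), {ω | ∑ i ∈ Finset.range (N n), X i ω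
          ≤ ∑ i ∈ Finset.range k, X i ω - ε * a n} := by
      ext ω
      simp
    rw [hset]
    refine (measureReal_biUnion_finset_le _ _).trans ?_
    refine (Finset.sum_le_card_nsmul _ _ _ fun k hk => hone n k (by simp at hk; omega)).trans ?_
    simp
  -- Half of the exponent `θ ε a_n` absorbs the union bound, as `N + 1 ≤ C n ≤ C a_n²`; the other
  -- half beats `K a_n² / n` because `a_n / n → 0`.
  have hpoly : ∀ᶠ n : ℕ in atTop, C * a n ^ 2 ≤ Real.exp (θ * ε / 2 * a n) := by
    have h1 := (Real.tendsto_mul_exp_add_div_pow_atTop 1 0 2 one_pos).comp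
      (ha_top.const_mul_atTop (show 0 < θ * ε / 2 by positivity))
    filter_upwards [h1.eventually_ge_atTop (C * (2 / (θ * ε)) ^ 2),
      ha_top.eventually_gt_atTop 0] with n hn hpos
    simp only [Function.comp_apply, one_mul, add_zero] at hn
    rw [le_div_iff₀ (by positivity)] at hn
    refine le_trans (le_of_eq ?_) hn
    field_simp
  have hspeed : ∀ᶠ n : ℕ in atTop, K * (a n / n) ≤ θ * ε / 2 := by
    have := ha_upper.const_mul K
    rw [mul_zero] at this
    exact (this.eventually_lt_const (show 0 < θ * ε / 2 by positivity)).mono fun n hn => hn.le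
  filter_upwards [hpoly, hspeed, hN, ha_sqrt, ha_top.eventually_gt_atTop 0,
    eventually_ge_atTop 1] with n h1 h2 h3 h4 h5 h6
  have hC : 0 ≤ C := by
    have : (0 : ℝ) < n := by positivity
    by_contra! hneg
    have := mul_neg_of_neg_of_pos hneg this
    have : (0 : ℝ) ≤ N n := Nat.cast_nonneg _
    linarith
  have h7 : (N n : ℝ) + 1 ≤ Real.exp (θ * ε / 2 * a n) :=
    h3.trans ((mul_le_mul_of_nonneg_left h4 hC).trans h1)
  refine (hunion n).trans ((mul_le_mul_of_nonneg_right h7 (Real.exp_pos _).le).trans ?_)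
  rw [← Real.exp_add, Real.exp_le_exp]
  have h8 := mul_le_mul_of_nonneg_right h2 h5.le
  have h9 : K * (a n / n) * a n = K * (a n ^ 2 / n) := by ring
  linarith

end PartialSums

/-! ### Hitting times versus partial sums. -/

section HittingTime

variable {Ω : Type*} {X : ℕ → Ω → ℝ} {n : ℕ} {r : ℝ} {ω : Ω}

theorem trajectory_natCast_div (hn : 1 ≤ n) (k : ℕ) :
    trajectory X n ((k : ℝ) / n) ω = ∑ i ∈ Finset.range k, X i ω := by
  have hn' : (n : ℝ) ≠ 0 := by positivity
  simp [trajectory, mul_div_cancel₀ _ hn']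

/-- The interpolated value is a convex combination of two consecutive partial sums, both of index at
most `N`. -/
theorem trajectory_lt {N : ℕ} {u c : ℝ} (hu : 0 ≤ u) (huN : n * u < N)
    (hlt : ∀ k ≤ N, ∑ i ∈ Finset.range k, X i ω < c) : trajectory X n u ω < c := by
  have h0 : 0 ≤ (n : ℝ) * u := by positivity
  set m := ⌊(n : ℝ) * u⌋₊ with hm
  have hmN : m < N := (Nat.floor_lt h0).2 huN
  have h1 := hlt m hmN.le
  have h2 := hlt (m + 1) hmN
  have hf0 : 0 ≤ (n : ℝ) * u - m := sub_nonneg.2 (Nat.floor_le h0)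
  have hf1 : 0 < 1 - ((n : ℝ) * u - m) := by
    have := Nat.lt_floor_add_one ((n : ℝ) * u)
    rw [← hm] at this
    linarith
  rw [Finset.sum_range_succ] at h2
  have h3 := mul_lt_mul_of_pos_left h1 hf1
  have h4 := mul_le_mul_of_nonneg_left h2.le hf0
  rw [trajectory, ← hm]
  linarith

theorem hittingTime_le_of_le_sum (hn : 1 ≤ n) {k : ℕ}
    (hk : n * r ≤ ∑ i ∈ Finset.range k, X i ω) :
    hittingTime X n r ω ≤ (((k : ℝ) / n : ℝ) : EReal) :=
  sInf_le ⟨(k : ℝ) / n, ⟨by positivity, by rwa [trajectory_natCast_div hn]⟩, rfl⟩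

theorem le_hittingTime_of_sum_lt (hn : 1 ≤ n) {N : ℕ}
    (hlt : ∀ k ≤ N, ∑ i ∈ Finset.range k, X i ω < n * r) :
    (((N : ℝ) / n : ℝ) : EReal) ≤ hittingTime X n r ω := by
  refine le_sInf ?_
  rintro _ ⟨u, ⟨hu, hcross⟩, rfl⟩
  rw [EReal.coe_le_coe_iff]
  by_contra! hlt'
  rw [lt_div_iff₀ (by positivity), mul_comm] at hlt'
  exact absurd hcross (not_le.2 (trajectory_lt hu hlt' hlt))

/-- The infinite values need separate treatment because the level may never be reached. -/
theorem coe_mul_sub_gt_iff {c ρ t : ℝ} (hc : 0 < c) (τ : EReal) :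
    (c : EReal) * (τ - (ρ : EReal)) > (t : EReal) ↔ ((ρ + t / c : ℝ) : EReal) < τ := by
  induction τ with
  | bot => simp [EReal.coe_mul_bot_of_pos hc]
  | top => simp only [EReal.top_sub_coe, EReal.coe_mul_top_of_pos hc, gt_iff_lt, EReal.coe_lt_top]
  | coe τ =>
    rw [gt_iff_lt, ← EReal.coe_sub, ← EReal.coe_mul, EReal.coe_lt_coe_iff, EReal.coe_lt_coe_iff,
      ← lt_sub_iff_add_lt', div_lt_iff₀' hc]

theorem coe_mul_sub_lt_iff {c ρ t : ℝ} (hc : 0 < c) (τ : EReal) :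
    (c : EReal) * (τ - (ρ : EReal)) < (t : EReal) ↔ τ < ((ρ + t / c : ℝ) : EReal) := by
  induction τ with
  | bot => simp [EReal.coe_mul_bot_of_pos hc, EReal.bot_lt_coe]
  | top => simp [EReal.coe_mul_top_of_pos hc]
  | coe τ =>
    rw [← EReal.coe_sub, ← EReal.coe_mul, EReal.coe_lt_coe_iff, EReal.coe_lt_coe_iff,
      ← sub_lt_iff_lt_add', lt_div_iff₀' hc]

end HittingTime

/-! ### The two moderate deviation limits. -/

theorem theorem1 {Ω : Type*} [MeasurableSpace Ω] (P : Measure Ω) [IsProbabilityMeasure P]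
    (X : ℕ → Ω → ℝ) (hX : ∀ i, Measurable (X i)) (hindep : iIndepFun X P)
    (hident : ∀ i, IdentDistrib (X i) (X 0) P P)
    (μ σ : ℝ) (hμ : 0 < μ) (hσ : 0 < σ)
    (hmean : ∫ ω, X 0 ω ∂P = μ) (hvar : variance (X 0) P = σ ^ 2)
    (h1 : LogMomentCondition (X 0) P) (h2 : SuperExponentialCondition (X 0) P)
    (a : ℕ → ℝ) (ha : ∀ n : ℕ, 1 ≤ n → 0 < a n)
    (ha_upper : Tendsto (fun n : ℕ => a n / (n : ℝ)) atTop (𝓝 0))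
    (ha_lower : Tendsto (fun n : ℕ => Real.sqrt (n : ℝ) / a n) atTop (𝓝 0))
    (r : ℝ) (hr0 : 0 < r) (hrμ : r < μ) (t : ℝ) (ht : 0 < t) :
    Tendsto (fun n : ℕ => (((n : ℝ) / a n ^ 2 : ℝ) : EReal) *
        ENNReal.log (P {ω | (((n : ℝ) / a n : ℝ) : EReal) *
          (hittingTime X n r ω - ((r / μ : ℝ) : EReal)) > ((t : ℝ) : EReal)}))
      atTop (𝓝 ((-(μ ^ 3 * t ^ 2 / (2 * σ ^ 2 * r)) : ℝ) : EReal)) ∧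
    Tendsto (fun n : ℕ => (((n : ℝ) / a n ^ 2 : ℝ) : EReal) *
        ENNReal.log (P {ω | (((n : ℝ) / a n : ℝ) : EReal) *
          (hittingTime X n r ω - ((r / μ : ℝ) : EReal)) < ((-t : ℝ) : EReal)}))
      atTop (𝓝 ((-(μ ^ 3 * t ^ 2 / (2 * σ ^ 2 * r)) : ℝ) : EReal)) := by
  have hint := h1.1
  have hsqrt_pos : ∀ᶠ n : ℕ in atTop, 0 < Real.sqrt n / a n := by
    filter_upwards [eventually_ge_atTop 1] with n hn
    have := ha n hn
    positivity
  have hratio : Tendsto (fun n : ℕ => a n / Real.sqrt n) atTop atTop := by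
    have := (tendsto_nhdsWithin_iff.2 ⟨ha_lower, hsqrt_pos⟩).inv_tendsto_nhdsGT_zero
    refine this.congr fun n => ?_
    simp
  have hsqrt_top : Tendsto (fun n : ℕ => Real.sqrt n) atTop atTop :=
    Real.tendsto_sqrt_atTop.comp tendsto_natCast_atTop_atTop
  have ha_top : Tendsto a atTop atTop := by
    refine (hratio.atTop_mul_atTop₀ hsqrt_top).congr' ?_
    filter_upwards [eventually_ge_atTop 1] with n hn
    have : Real.sqrt n ≠ 0 := by positivity
    field_simp
  have hspeed : Tendsto (fun n : ℕ => a n ^ 2 / (n : ℝ)) atTop atTop := by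
    refine (hratio.atTop_mul_atTop₀ hratio).congr fun n => ?_
    rw [div_mul_div_comm, Real.mul_self_sqrt (Nat.cast_nonneg n), sq]
  have ha_sqrt : ∀ᶠ n : ℕ in atTop, (n : ℝ) ≤ a n ^ 2 := by
    filter_upwards [hspeed.eventually_ge_atTop 1, eventually_ge_atTop 1] with n hn hn'
    rwa [le_div_iff₀ (by positivity), one_mul] at hn
  have hincr := fun (N : ℕ → ℕ) (C : ℝ) (hN : ∀ᶠ n in atTop, (N n : ℝ) + 1 ≤ C * n) (ε : ℝ)
      (hε : 0 < ε) (K : ℝ) => eventually_measure_increment_le hX hindep hident hint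
    (hmean ▸ hμ) ha_upper ha_top ha_sqrt hN hε K
  have hgauss := fun (e : ℝ) (he : e ^ 2 = 1) (N : ℕ → ℕ) (T : ℕ → ℝ)
      (hNT : ∀ᶠ n in atTop, |(N n : ℝ) - T n| ≤ 2)
      (hT : Tendsto (fun n => T n / (n : ℝ)) atTop (𝓝 (r / μ))) =>
    hasGaussianScaledCgf_sum hX hindep hident hint hmean hvar he ha ha_upper ha_top hNT hT
  have hcenter : ∀ b : ℝ,
      Tendsto (fun n : ℕ => ((n : ℝ) * (r / μ) + b * a n) / n) atTop (𝓝 (r / μ)) := fun b => by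
    have := (ha_upper.const_mul b).const_add (r / μ)
    rw [mul_zero, add_zero] at this
    refine this.congr' ?_
    filter_upwards [eventually_ge_atTop 1] with n hn
    have : (n : ℝ) ≠ 0 := by positivity
    field_simp
  have hlarge : ∀ b : ℝ, ∀ᶠ n : ℕ in atTop, 1 ≤ (n : ℝ) * (r / μ) + b * a n := fun b => by
    have := (hcenter b).pos_mul_atTop (by positivity) tendsto_natCast_atTop_atTop
    filter_upwards [this.eventually_ge_atTop 1, eventually_ge_atTop 1] with n hn hn'
    rwa [div_mul_cancel₀ _ (by positivity)] at hn
  -- Eventually the centre is below `(r / μ + 1) n`, and the two added units cost at most `2 n`.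
  have hlinear : ∀ b : ℝ, ∀ᶠ n : ℕ in atTop,
      ((⌊(n : ℝ) * (r / μ) + b * a n⌋₊ + 1 : ℕ) : ℝ) + 1 ≤ (r / μ + 3) * n := fun b => by
    filter_upwards [(hcenter b).eventually_lt_const (show r / μ < r / μ + 1 by linarith),
      hlarge b, eventually_ge_atTop 1] with n hn hn' hn1
    have hn1' : (1 : ℝ) ≤ n := by exact_mod_cast hn1
    rw [div_lt_iff₀ (by positivity)] at hn
    have := Nat.floor_le (zero_le_one.trans hn')
    push_cast
    linarith
  have hκ : 0 < σ ^ 2 * (r / μ) := by positivity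
  have hrate : μ ^ 3 * t ^ 2 / (2 * σ ^ 2 * r) = (μ * t) ^ 2 / (2 * (σ ^ 2 * (r / μ))) := by
    field_simp
  have hfloor : ∀ b : ℝ, ∀ᶠ n : ℕ in atTop,
      |(⌊(n : ℝ) * (r / μ) + b * a n⌋₊ : ℝ) - ((n : ℝ) * (r / μ) + b * a n)| ≤ 1 := fun b => by
    filter_upwards [hlarge b] with n hn
    have := Nat.floor_le (zero_le_one.trans hn)
    have := Nat.lt_floor_add_one ((n : ℝ) * (r / μ) + b * a n)
    rw [abs_le]
    constructor <;> linarith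
  have hfloor_succ : ∀ b : ℝ, ∀ᶠ n : ℕ in atTop,
      |((⌊(n : ℝ) * (r / μ) + b * a n⌋₊ + 1 : ℕ) : ℝ) - ((n : ℝ) * (r / μ) + b * a n)| ≤ 2 :=
    fun b => by
    filter_upwards [hfloor b] with n hn
    rw [abs_le] at hn ⊢
    push_cast
    constructor <;> linarith
  have hfloor_pred : ∀ b : ℝ, ∀ᶠ n : ℕ in atTop,
      |((⌊(n : ℝ) * (r / μ) + b * a n⌋₊ - 1 : ℕ) : ℝ) - ((n : ℝ) * (r / μ) + b * a n)| ≤ 2 :=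
    fun b => by
    filter_upwards [hfloor b, hlarge b] with n hn hn'
    rw [Nat.cast_sub (Nat.one_le_floor_iff _ |>.2 hn'), abs_le]
    rw [abs_le] at hn
    push_cast
    constructor <;> linarith
  have htime : ∀ b : ℝ, ∀ n : ℕ, 1 ≤ n →
      r / μ + b / (n / a n) = ((n : ℝ) * (r / μ) + b * a n) / n := fun b n hn => by
    have : (n : ℝ) ≠ 0 := by positivity
    have := (ha n hn).ne'
    field_simp
  have hmul : ∀ b (n : ℕ), μ * ((n : ℝ) * (r / μ) + b * a n) = n * r + b * μ * a n :=
    fun b n => by field_simp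
  have hinv : (fun n : ℕ => (n : ℝ) / a n ^ 2) = fun n => (a n ^ 2 / (n : ℝ))⁻¹ := by
    ext n
    rw [inv_div]
  simp_rw [hrate, fun n : ℕ => congrFun hinv n]
  constructor
  -- Late hitting. A hitting time beyond `T / n` forces the sum at `⌊T⌋` below `n r`, with no
  -- exceptional set. Conversely, a sum at `⌊T⌋ + 1` below `n r - ε a_n` keeps all earlier sums
  -- below `n r` unless the walk drops; the extra step makes the time strictly larger than `T / n`.
  · refine tendsto_log_measure_of_sandwich
      (hgauss (-1) (by norm_num) (fun n => ⌊(n : ℝ) * (r / μ) + t * a n⌋₊) _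
        ((hfloor t).mono fun n hn => hn.trans (by norm_num)) (hcenter t))
      (hgauss (-1) (by norm_num) (fun n => ⌊(n : ℝ) * (r / μ) + t * a n⌋₊ + 1) _
        (hfloor_succ t) (hcenter t)) hspeed hκ (by positivity) _ _
      (fun ε hε K => hincr (fun n => ⌊(n : ℝ) * (r / μ) + t * a n⌋₊ + 1) _ (hlinear t) ε hε K)
      (fun ε hε => ?_) (fun ε hε => ?_)
    · filter_upwards [hlarge t, eventually_ge_atTop 1] with n hn hn1 ω hω
      have hapos := ha n hn1
      have hnpos : (0 : ℝ) < n := by positivity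
      left
      rw [Set.mem_ofPred_eq, coe_mul_sub_gt_iff (by positivity), htime t n hn1] at hω
      have hsum : ∑ i ∈ Finset.range ⌊(n : ℝ) * (r / μ) + t * a n⌋₊, X i ω < n * r := by
        by_contra! hge
        refine absurd (hω.trans_le (hittingTime_le_of_le_sum hn1 hge)) (not_lt.2 ?_)
        rw [EReal.coe_le_coe_iff]
        have := Nat.floor_le (zero_le_one.trans hn)
        gcongr
      rw [Set.mem_ofPred_eq, hmul, le_div_iff₀ hapos]
      have := mul_pos hε hapos
      linarith
    · filter_upwards [eventually_ge_atTop 1] with n hn1 ω hω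
      have hapos := ha n hn1
      have hnpos : (0 : ℝ) < n := by positivity
      rw [Set.mem_ofPred_eq, hmul, lt_div_iff₀ hapos] at hω
      by_cases hD : ω ∈ {ω | ∃ k ≤ ⌊(n : ℝ) * (r / μ) + t * a n⌋₊ + 1,
        ∑ i ∈ Finset.range (⌊(n : ℝ) * (r / μ) + t * a n⌋₊ + 1), X i ω
          ≤ ∑ i ∈ Finset.range k, X i ω - ε * a n}
      · exact Or.inr hD
      left
      rw [Set.mem_ofPred_eq] at hD
      push Not at hD
      rw [Set.mem_ofPred_eq, coe_mul_sub_gt_iff (by positivity), htime t n hn1]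
      refine lt_of_lt_of_le ?_ (le_hittingTime_of_sum_lt hn1
        (N := ⌊(n : ℝ) * (r / μ) + t * a n⌋₊ + 1) fun k hk => ?_)
      · rw [EReal.coe_lt_coe_iff]
        have := Nat.lt_floor_add_one ((n : ℝ) * (r / μ) + t * a n)
        push_cast
        gcongr
      · have := hD k hk
        linarith
  -- Early hitting, with the roles exchanged. A crossing before `T / n` gives some `k ≤ ⌊T⌋ + 1`
  -- with sum at least `n r`, and without a drop the sum at `⌊T⌋ + 1` is still above `n r - ε a_n`.
  -- Conversely, a large sum at `⌊T⌋ - 1` already forces a hit strictly before `T / n`; the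
  -- subtraction is not truncated since eventually `T ≥ 1`.
  · refine tendsto_log_measure_of_sandwich
      (hgauss 1 (by norm_num) (fun n => ⌊(n : ℝ) * (r / μ) + -t * a n⌋₊ + 1) _
        (hfloor_succ (-t)) (hcenter (-t)))
      (hgauss 1 (by norm_num) (fun n => ⌊(n : ℝ) * (r / μ) + -t * a n⌋₊ - 1) _
        (hfloor_pred (-t)) (hcenter (-t))) hspeed hκ (by positivity) _ _
      (fun ε hε K => hincr (fun n => ⌊(n : ℝ) * (r / μ) + -t * a n⌋₊ + 1) _ (hlinear (-t)) ε hε K)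
      (fun ε hε => ?_) (fun ε hε => ?_)
    · filter_upwards [eventually_ge_atTop 1] with n hn1 ω hω
      have hapos := ha n hn1
      have hnpos : (0 : ℝ) < n := by positivity
      rw [Set.mem_ofPred_eq, coe_mul_sub_lt_iff (by positivity), htime (-t) n hn1] at hω
      obtain ⟨k, hk, hsum⟩ : ∃ k ≤ ⌊(n : ℝ) * (r / μ) + -t * a n⌋₊ + 1,
          n * r ≤ ∑ i ∈ Finset.range k, X i ω := by
        by_contra! hlt
        refine absurd ((le_hittingTime_of_sum_lt hn1 hlt).trans_lt hω) (not_lt.2 ?_)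
        rw [EReal.coe_le_coe_iff]
        have := Nat.lt_floor_add_one ((n : ℝ) * (r / μ) + -t * a n)
        push_cast
        gcongr
      by_cases hD : ω ∈ {ω | ∃ k ≤ ⌊(n : ℝ) * (r / μ) + -t * a n⌋₊ + 1,
        ∑ i ∈ Finset.range (⌊(n : ℝ) * (r / μ) + -t * a n⌋₊ + 1), X i ω
          ≤ ∑ i ∈ Finset.range k, X i ω - ε * a n}
      · exact Or.inr hD
      left
      rw [Set.mem_ofPred_eq] at hD
      push Not at hD
      have := hD k hk
      rw [Set.mem_ofPred_eq, hmul, le_div_iff₀ hapos]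
      linarith
    · filter_upwards [hlarge (-t), eventually_ge_atTop 1] with n hn hn1 ω hω
      have hapos := ha n hn1
      have hnpos : (0 : ℝ) < n := by positivity
      left
      rw [Set.mem_ofPred_eq, hmul, lt_div_iff₀ hapos] at hω
      rw [Set.mem_ofPred_eq, coe_mul_sub_lt_iff (by positivity), htime (-t) n hn1]
      have hsum : n * r
          ≤ ∑ i ∈ Finset.range (⌊(n : ℝ) * (r / μ) + -t * a n⌋₊ - 1), X i ω := by
        have := mul_pos hε hapos
        linarith
      refine (hittingTime_le_of_le_sum hn1 hsum).trans_lt ?_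
      rw [EReal.coe_lt_coe_iff, Nat.cast_sub (Nat.one_le_floor_iff _ |>.2 hn)]
      have := Nat.floor_le (zero_le_one.trans hn)
      push_cast
      gcongr
      linarith
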